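/- Let $A$ and $B$ be real symmetric $n\times n$ matrices, and let $O\neq I$ be a real orthogonal $n\times n$ matrix that commutes with both $A$ and $B$. For $t\in\mathbb R$ put $H_t=A+tB$. Let $e_1,\dots,e_n$ be the standard basis of $\mathbb R^n$. (1) If $O^2\neq I$, then for every $t\in\mathbb R$ the matrix $H_t$ has degenerate spectrum, that is, some eigenvalue of $H_t$ has multiplicity at least $2$. (2) For every $j$ such that $Oe_j=e_j$ there is a real-analytic map $\varphi:\mathbb R\to\mathbb R^n$, $t\mapsto\varphi_t$, such that for every $t\in\mathbb R$ the vector $\varphi_t$ is an eigenvector of $H_t$ (in particular $\varphi_t\neq 0$) and its $j$-th entry $\varphi_t(j)$ is $0$. -/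

import Mathlib

/-- The one-parameter family `H_t(A, B) = A + t B`. -/
def pencil {n : ℕ} (A B : Matrix (Fin n) (Fin n) ℝ) (t : ℝ) : Matrix (Fin n) (Fin n) ℝ :=
  A + t • B

/-- A matrix has degenerate spectrum when some eigenvalue is not simple, i.e. has an eigenspace
of dimension at least two. This is used for real symmetric matrices only, where all eigenvalues
are real and geometric and algebraic multiplicities agree. -/
def HasDegenerateSpectrum {n : ℕ} (M : Matrix (Fin n) (Fin n) ℝ) : Prop :=
  ∃ μ : ℝ, 2 ≤ Module.finrank ℝ (Module.End.eigenspace (Matrix.toLin' M) μ)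

/-! Degeneracy: if every eigenspace of `H_t` were a line, the skew matrix `O - Oᵀ`, which commutes
with `H_t`, would map each eigenvector to a multiple of itself and, being skew, to zero. Then `O` is
symmetric and `O ^ 2 = O * Oᵀ = 1` (`hasDegenerateSpectrum_of_commute`).

Eigenvectors: the range of `O - 1` is nonzero, invariant under `A` and `B`, and orthogonal to every
fixed `e_j`. An analytic eigenvector of the pencil restricted to this range is therefore enough
(`exists_analytic_eigenvector_mem`).

Its eigenvalue comes from Rellich's theorem (`hasAnalyticRootsAt`). Centre the roots of the
characteristic polynomial; real-rootedness makes them all `O(|t - t₀| ^ k)`, where `2 * k` is the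
vanishing order of the second symmetric function. Dividing them by `(t - t₀) ^ k` leaves at least
two distinct roots at `t₀`, so Hensel's lemma (`exists_analytic_factorization`) splits the
polynomial and induction on the degree applies. The local root functions continue to all of `ℝ` by
the identity theorem. Given an analytic eigenvalue, linear algebra over a domain of analytic
functions yields a kernel vector, whose finitely many common zeros are divided out
(`exists_nonvanishing_kernel_vector`). -/

open Polynomial Filter Topology

/-! ### Hensel's lemma for analytic families of monic polynomials -/

/-- The polynomial of degree less than `k` with given coefficients. -/
noncomputable def lowPoly (k : ℕ) : (Fin k → ℝ) →ₗ[ℝ] ℝ[X] :=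
  (degreeLT ℝ k).subtype ∘ₗ (degreeLTEquiv ℝ k).symm.toLinearMap

theorem lowPoly_degree_lt (k : ℕ) (u : Fin k → ℝ) : (lowPoly k u).degree < k :=
  mem_degreeLT.1 ((degreeLTEquiv ℝ k).symm u).2

theorem coeff_lowPoly {k i : ℕ} (u : Fin k → ℝ) (hi : i < k) :
    (lowPoly k u).coeff i = u ⟨i, hi⟩ :=
  congrFun ((degreeLTEquiv ℝ k).apply_symm_apply u) ⟨i, hi⟩

theorem lowPoly_injective (k : ℕ) : Function.Injective (lowPoly k) :=
  Subtype.val_injective.comp (degreeLTEquiv ℝ k).symm.injective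

theorem monic_X_pow_add_lowPoly (k : ℕ) (u : Fin k → ℝ) : (X ^ k + lowPoly k u).Monic :=
  monic_X_pow_add (lowPoly_degree_lt k u)

theorem natDegree_X_pow_add_lowPoly (k : ℕ) (u : Fin k → ℝ) :
    (X ^ k + lowPoly k u).natDegree = k := by
  apply natDegree_eq_of_degree_eq_some
  rw [degree_add_eq_left_of_degree_lt] <;> rw [degree_X_pow]
  exact lowPoly_degree_lt k u

theorem exists_eq_X_pow_add_lowPoly {p : ℝ[X]} (hp : p.Monic) :
    ∃ u, p = X ^ p.natDegree + lowPoly p.natDegree u := by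
  have h : p - X ^ p.natDegree ∈ degreeLT ℝ p.natDegree := by
    rw [mem_degreeLT]
    have := degree_sub_lt_left (p := p) (q := X ^ p.natDegree)
      (by rw [degree_X_pow, degree_eq_natDegree hp.ne_zero]) hp.ne_zero
      (by rw [hp.leadingCoeff, (monic_X_pow _).leadingCoeff])
    rwa [degree_eq_natDegree hp.ne_zero] at this
  refine ⟨degreeLTEquiv ℝ p.natDegree ⟨_, h⟩, ?_⟩
  simp [lowPoly]

/-- The coefficients below the leading one of the product of the monic polynomials with lower
coefficients `u` and `v`. -/
noncomputable def mulCoeffs (k l : ℕ) (w : (Fin k → ℝ) × (Fin l → ℝ)) : Fin (k + l) → ℝ :=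
  fun i => ((X ^ k + lowPoly k w.1) * (X ^ l + lowPoly l w.2)).coeff i

/-- The linear part of `mulCoeffs`, at the monic polynomials `q` and `r`. -/
noncomputable def mulCoeffsDeriv (k l : ℕ) (q r : ℝ[X]) :
    ((Fin k → ℝ) × (Fin l → ℝ)) →L[ℝ] (Fin (k + l) → ℝ) :=
  LinearMap.toContinuousLinearMap <| LinearMap.pi fun i =>
    lcoeff ℝ i ∘ₗ (LinearMap.mulLeft ℝ q ∘ₗ lowPoly l ∘ₗ LinearMap.snd ℝ _ _ +
      LinearMap.mulLeft ℝ r ∘ₗ lowPoly k ∘ₗ LinearMap.fst ℝ _ _)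

theorem hasStrictFDerivAt_coeff_lowPoly (k a : ℕ) (u : Fin k → ℝ) :
    HasStrictFDerivAt (fun u : Fin k → ℝ => (X ^ k + lowPoly k u).coeff a)
      (LinearMap.toContinuousLinearMap (lcoeff ℝ a ∘ₗ lowPoly k)) u := by
  simp only [coeff_add]
  exact (LinearMap.toContinuousLinearMap (lcoeff ℝ a ∘ₗ lowPoly k)).hasStrictFDerivAt.const_add _

theorem analyticAt_coeff_lowPoly (k a : ℕ) (u : Fin k → ℝ) :
    AnalyticAt ℝ (fun u : Fin k → ℝ => (X ^ k + lowPoly k u).coeff a) u := by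
  simp only [coeff_add]
  exact analyticAt_const.add
    ((LinearMap.toContinuousLinearMap (lcoeff ℝ a ∘ₗ lowPoly k)).analyticAt u)

theorem hasStrictFDerivAt_mulCoeffs (k l : ℕ) (w : (Fin k → ℝ) × (Fin l → ℝ)) :
    HasStrictFDerivAt (mulCoeffs k l)
      (mulCoeffsDeriv k l (X ^ k + lowPoly k w.1) (X ^ l + lowPoly l w.2)) w := by
  rw [hasStrictFDerivAt_pi']
  intro i
  have h := HasStrictFDerivAt.fun_sum (u := Finset.HasAntidiagonal.antidiagonal (i : ℕ)) fun x _ =>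
    ((hasStrictFDerivAt_coeff_lowPoly k x.1 w.1).comp w
      (hasStrictFDerivAt_fst (𝕜 := ℝ) (p := w))).mul
    ((hasStrictFDerivAt_coeff_lowPoly l x.2 w.2).comp w
      (hasStrictFDerivAt_snd (𝕜 := ℝ) (p := w)))
  refine (h.congr_fderiv ?_).congr_of_eventuallyEq (.of_forall fun y => ?_)
  · refine ContinuousLinearMap.ext fun y => ?_
    simp only [mulCoeffsDeriv, ContinuousLinearMap.comp_apply, ContinuousLinearMap.proj_apply,
      LinearMap.coe_toContinuousLinearMap', LinearMap.pi_apply, LinearMap.comp_apply,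
      LinearMap.add_apply, LinearMap.mulLeft_apply, lcoeff_apply, coeff_add, coeff_mul,
      LinearMap.fst_apply, LinearMap.snd_apply, sum_apply, add_apply, smul_apply, smul_eq_mul,
      Finset.sum_add_distrib, ContinuousLinearMap.coe_fst', ContinuousLinearMap.coe_snd']
    congr 1
    rw [← Finset.Nat.sum_antidiagonal_swap (n := (i : ℕ))]
    rfl
  · simp [mulCoeffs, coeff_mul]

theorem analyticAt_mulCoeffs (k l : ℕ) (w : (Fin k → ℝ) × (Fin l → ℝ)) :
    AnalyticAt ℝ (mulCoeffs k l) w := by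
  rw [analyticAt_pi_iff]
  intro i
  simp only [mulCoeffs, coeff_mul]
  refine Finset.analyticAt_fun_sum _ fun x _ => ?_
  exact ((analyticAt_coeff_lowPoly k x.1 w.1).comp analyticAt_fst).mul
    ((analyticAt_coeff_lowPoly l x.2 w.2).comp analyticAt_snd)

/-- A kernel element gives `q * v + r * u = 0`; coprimality forces `q ∣ u`, and `deg u < deg q` then
gives `u = 0`, hence `v = 0`. This is the nondegeneracy needed for the inverse function theorem. -/
theorem mulCoeffsDeriv_injective (k l : ℕ) {q r : ℝ[X]} (hq : q.natDegree = k)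
    (hr : r.natDegree = l) (hq' : q.Monic) (hr' : r.Monic) (hc : IsCoprime q r) :
    Function.Injective (mulCoeffsDeriv k l q r) := by
  rw [injective_iff_map_eq_zero]
  rintro ⟨u, v⟩ h
  have h0 : q * lowPoly l v + r * lowPoly k u = 0 := by
    ext i
    by_cases hi : i < k + l
    · simpa [mulCoeffsDeriv] using congrFun h ⟨i, hi⟩
    · rw [coeff_zero]
      apply coeff_eq_zero_of_degree_lt
      refine lt_of_lt_of_le ?_ (Nat.cast_le.2 (not_lt.1 hi))
      have hqd := degree_eq_natDegree hq'.ne_zero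
      have hrd := degree_eq_natDegree hr'.ne_zero
      refine lt_of_le_of_lt (degree_add_le _ _) (max_lt ?_ ?_)
      · rw [degree_mul, hqd, hq, Nat.cast_add]
        exact WithBot.add_lt_add_left (by simp) (lowPoly_degree_lt l v)
      · rw [degree_mul, hrd, hr, add_comm k l, Nat.cast_add]
        exact WithBot.add_lt_add_left (by simp) (lowPoly_degree_lt k u)
  have hu : lowPoly k u = 0 := by
    refine eq_zero_of_dvd_of_degree_lt (p := q) ?_ ?_
    · exact hc.dvd_of_dvd_mul_left ⟨-lowPoly l v, by linear_combination h0⟩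
    · rw [degree_eq_natDegree hq'.ne_zero, hq]; exact lowPoly_degree_lt k u
  have hv : lowPoly l v = 0 := by
    rw [hu, mul_zero, add_zero] at h0
    exact (mul_eq_zero.1 h0).resolve_left hq'.ne_zero
  rw [Prod.mk_eq_zero]
  exact ⟨lowPoly_injective k (by simpa using hu), lowPoly_injective l (by simpa using hv)⟩

/-- Hensel's lemma for monic polynomials with analytic coefficients. -/
theorem exists_analytic_factorization {p : ℝ → ℝ[X]} {t₀ : ℝ} {m : ℕ}
    (hm : ∀ t, (p t).Monic) (hd : ∀ t, (p t).natDegree = m)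
    (ha : ∀ i, AnalyticAt ℝ (fun t => (p t).coeff i) t₀) {q r : ℝ[X]} (hq : q.Monic)
    (hr : r.Monic) (hc : IsCoprime q r) (hpqr : p t₀ = q * r) :
    ∃ Q R : ℝ → ℝ[X], (∀ t, (Q t).Monic) ∧ (∀ t, (R t).Monic) ∧
      (∀ t, (Q t).natDegree = q.natDegree) ∧ (∀ t, (R t).natDegree = r.natDegree) ∧
      (∀ i, AnalyticAt ℝ (fun t => (Q t).coeff i) t₀) ∧
      (∀ i, AnalyticAt ℝ (fun t => (R t).coeff i) t₀) ∧ ∀ᶠ t in 𝓝 t₀, p t = Q t * R t := by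
  obtain ⟨u, hu⟩ := exists_eq_X_pow_add_lowPoly hq
  obtain ⟨v, hv⟩ := exists_eq_X_pow_add_lowPoly hr
  generalize hk : q.natDegree = k at *
  generalize hl : r.natDegree = l at *
  have hD := hasStrictFDerivAt_mulCoeffs k l (u, v)
  simp only [← hu, ← hv] at hD
  let e := (LinearEquiv.ofInjectiveOfFinrankEq (mulCoeffsDeriv k l q r).toLinearMap
    (mulCoeffsDeriv_injective k l hk hl hq hr hc) (by simp)).toContinuousLinearEquiv
  have he : (e : _ →L[ℝ] _) = mulCoeffsDeriv k l q r := by ext1 <;> rfl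
  rw [← he] at hD
  -- The local inverse of multiplication is analytic, so the factors depend analytically on the
  -- coefficients of the product.
  let Ψ := hD.toOpenPartialHomeomorph (mulCoeffs k l)
  have hΨ : AnalyticAt ℝ Ψ.symm (mulCoeffs k l (u, v)) :=
    Ψ.analyticAt_symm' hD.mem_toOpenPartialHomeomorph_source (analyticAt_mulCoeffs k l _)
      hD.hasFDerivAt.fderiv
  let c : ℝ → Fin (k + l) → ℝ := fun t i => (p t).coeff i
  have hc0 : c t₀ = mulCoeffs k l (u, v) := by
    ext i; simp only [c, mulCoeffs, ← hu, ← hv, hpqr]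
  have hca : AnalyticAt ℝ c t₀ := analyticAt_pi_iff.2 fun i => ha i
  have hw : AnalyticAt ℝ (fun t => Ψ.symm (c t)) t₀ := by
    rw [← hc0] at hΨ
    exact hΨ.comp hca
  refine ⟨fun t => X ^ k + lowPoly k (Ψ.symm (c t)).1, fun t => X ^ l + lowPoly l (Ψ.symm (c t)).2,
    fun t => monic_X_pow_add_lowPoly _ _, fun t => monic_X_pow_add_lowPoly _ _,
    fun t => natDegree_X_pow_add_lowPoly _ _, fun t => natDegree_X_pow_add_lowPoly _ _,
    fun i => ?_, fun i => ?_, ?_⟩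
  · exact (analyticAt_coeff_lowPoly k i _).comp (analyticAt_fst.comp hw)
  · exact (analyticAt_coeff_lowPoly l i _).comp (analyticAt_snd.comp hw)
  · have hev : ∀ᶠ t in 𝓝 t₀, mulCoeffs k l (Ψ.symm (c t)) = c t := by
      have := hD.eventually_right_inverse
      rw [← hc0] at this
      exact hca.continuousAt.eventually this
    have hmkl : m = k + l := by rw [← hd t₀, hpqr, hq.natDegree_mul hr, hk, hl]
    filter_upwards [hev] with t ht
    have hM := (monic_X_pow_add_lowPoly k (Ψ.symm (c t)).1).mul
      (monic_X_pow_add_lowPoly l (Ψ.symm (c t)).2)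
    have hN : ((X ^ k + lowPoly k (Ψ.symm (c t)).1) *
        (X ^ l + lowPoly l (Ψ.symm (c t)).2)).natDegree = k + l := by
      rw [(monic_X_pow_add_lowPoly _ _).natDegree_mul (monic_X_pow_add_lowPoly _ _),
        natDegree_X_pow_add_lowPoly, natDegree_X_pow_add_lowPoly]
    ext i
    rcases lt_trichotomy i (k + l) with hi | rfl | hi
    · exact (congrFun ht ⟨i, hi⟩).symm
    · have h1 := (hm t).coeff_natDegree
      have h2 := hM.coeff_natDegree
      rw [hd, hmkl] at h1
      rw [hN] at h2
      rw [h1, h2]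
    · rw [coeff_eq_zero_of_natDegree_lt (by rwa [hd, hmkl]),
        coeff_eq_zero_of_natDegree_lt (by rwa [hN])]

/-! ### Real-rooted polynomials: root bounds, limits, coprime splitting -/

theorem Multiset.sum_sq_eq_sum_map_sq_add {R : Type*} [CommRing R] (s : Multiset R) :
    s.sum ^ 2 = (s.map (· ^ 2)).sum + 2 * s.esymm 2 := by
  have h1 : ∀ s : Multiset R, s.esymm 1 = s.sum := fun s => by
    simp [Multiset.esymm, Multiset.powersetCard_one]
  induction s using Multiset.induction with
  | empty => simp [Multiset.esymm, show (2 : ℕ) = 1 + 1 from rfl, Multiset.powersetCard_zero_right]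
  | cons a s ih =>
    have : (a ::ₘ s).esymm 2 = s.esymm 2 + a * s.esymm 1 := by
      simp [Multiset.esymm, Multiset.powersetCard_cons, Multiset.map_map,
        Multiset.sum_map_mul_left]
    rw [this, h1, Multiset.sum_cons, Multiset.map_cons, Multiset.sum_cons]
    linear_combination ih

theorem sum_roots_sq {p : ℝ[X]} {m : ℕ} (hp : p.Monic) (hs : p.Splits)
    (hd : p.natDegree = m + 2) :
    (p.roots.map (· ^ 2)).sum = p.coeff (m + 1) ^ 2 - 2 * p.coeff m := by
  have h1 : p.roots.esymm 1 = p.roots.sum := by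
    simp [Multiset.esymm, Multiset.powersetCard_one]
  have hc := hs.natDegree_eq_card_roots.symm
  rw [coeff_eq_esymm_roots_of_card hc (by omega), coeff_eq_esymm_roots_of_card hc (by omega),
    hp.leadingCoeff, hd, show m + 2 - (m + 1) = 1 by omega, show m + 2 - m = 2 by omega, h1]
  linear_combination -p.roots.sum_sq_eq_sum_map_sq_add

/-- With centred real roots, Newton's identity turns a single coefficient into the sum of squares,
which dominates each square. -/
theorem sq_root_le {p : ℝ[X]} {m : ℕ} (hp : p.Monic) (hs : p.Splits)
    (hd : p.natDegree = m + 2) (h0 : p.coeff (m + 1) = 0) {x : ℝ} (hx : x ∈ p.roots) :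
    x ^ 2 ≤ -2 * p.coeff m := by
  have h := sum_roots_sq hp hs hd
  have : x ^ 2 ≤ (p.roots.map (· ^ 2)).sum :=
    Multiset.single_le_sum (fun y hy => by
      obtain ⟨z, -, rfl⟩ := Multiset.mem_map.1 hy
      positivity) _ (Multiset.mem_map_of_mem _ hx)
  rw [h, h0] at this
  linarith

theorem eq_X_pow_of_forall_roots_eq_zero {p : ℝ[X]} (hp : p.Monic) (hs : p.Splits)
    (h : ∀ x ∈ p.roots, x = 0) : p = X ^ p.natDegree := by
  conv_lhs => rw [hs.eq_prod_roots_of_monic hp, Multiset.eq_replicate_of_mem h]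
  rw [hs.natDegree_eq_card_roots]
  simp

/-- Each factor `z - a` with `a` real has norm at least `|z.im|`. The bound survives limits and so
keeps nonreal roots from appearing there. -/
theorem abs_im_pow_le_norm_eval {p : ℝ[X]} (hp : p.Monic) (hs : p.Splits) (z : ℂ) :
    |z.im| ^ p.natDegree ≤ ‖aeval z p‖ := by
  have h : aeval z p = (p.roots.map fun a : ℝ => z - (a : ℂ)).prod := by
    conv_lhs => rw [hs.eq_prod_roots_of_monic hp]
    rw [map_multiset_prod, Multiset.map_map]
    simp
  rw [h, hs.natDegree_eq_card_roots]
  generalize p.roots = s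
  induction s using Multiset.induction with
  | empty => simp
  | cons a s ih =>
    rw [Multiset.map_cons, Multiset.prod_cons, norm_mul, Multiset.card_cons, pow_succ']
    refine mul_le_mul ?_ ih (by positivity) (by positivity)
    simpa using Complex.abs_im_le_norm (z - a)

/-- A limit of monic real-rooted polynomials of the same degree is real-rooted. -/
theorem splits_of_tendsto {ι : Type*} {l : Filter ι} [l.NeBot] {q : ι → ℝ[X]} {q₀ : ℝ[X]}
    (hm : ∀ i, (q i).Monic) (hd : ∀ i, (q i).natDegree = q₀.natDegree) (hm₀ : q₀.Monic)
    (hs : ∀ᶠ i in l, (q i).Splits)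
    (hc : ∀ k, Tendsto (fun i => (q i).coeff k) l (𝓝 (q₀.coeff k))) : q₀.Splits := by
  refine Splits.of_splits_map (algebraMap ℝ ℂ) (IsAlgClosed.splits _) fun z hz => ?_
  have hz0 : aeval z q₀ = 0 := by
    rw [mem_roots (map_monic_ne_zero hm₀), IsRoot.def, eval_map_algebraMap] at hz
    exact hz
  have hlim : Tendsto (fun i => ‖aeval z (q i)‖) l (𝓝 ‖aeval z q₀‖) := by
    refine Tendsto.norm ?_
    simp only [aeval_eq_sum_range, hd]
    exact tendsto_finsetSum _ fun k _ => (hc k).smul_const _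
  have hle : |z.im| ^ q₀.natDegree ≤ ‖aeval z q₀‖ := by
    refine ge_of_tendsto hlim (hs.mono fun i hi => ?_)
    rw [← hd i]
    exact abs_im_pow_le_norm_eval (hm i) hi z
  rw [hz0, norm_zero] at hle
  have him : z.im = 0 := by
    by_contra h
    exact absurd (pow_pos (abs_pos.2 h) _) (not_lt.2 hle)
  exact ⟨z.re, Complex.ext (by simp) (by simp [him])⟩

/-- Roots with sum zero that are not all zero include two distinct ones; split off one nonzero root
with its full multiplicity. -/
theorem exists_coprime_factorization {p : ℝ[X]} {m : ℕ} (hp : p.Monic) (hs : p.Splits)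
    (hd : p.natDegree = m + 2) (h1 : p.coeff (m + 1) = 0) (h0 : p.coeff m ≠ 0) :
    ∃ q r : ℝ[X], q.Monic ∧ r.Monic ∧ IsCoprime q r ∧ p = q * r ∧
      q.natDegree < p.natDegree ∧ r.natDegree < p.natDegree := by
  obtain ⟨a, ha, hane⟩ : ∃ a ∈ p.roots, a ≠ 0 := by
    by_contra! h
    have := eq_X_pow_of_forall_roots_eq_zero hp hs h
    rw [hd] at this
    rw [this, coeff_X_pow, if_neg (by omega)] at h0
    exact h0 rfl
  obtain ⟨r, hr, hra⟩ := exists_eq_pow_rootMultiplicity_mul_and_not_dvd p hp.ne_zero a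
  have hq : ((X - C a) ^ p.rootMultiplicity a).Monic := (monic_X_sub_C a).pow _
  have hrm : r.Monic := hq.of_mul_monic_left (hr ▸ hp)
  have he : 0 < p.rootMultiplicity a :=
    (rootMultiplicity_pos hp.ne_zero).2 ((mem_roots hp.ne_zero).1 ha)
  generalize p.rootMultiplicity a = e at *
  have hdeg : p.natDegree = e + r.natDegree := by
    rw [hr, hq.natDegree_mul hrm, (monic_X_sub_C a).natDegree_pow, natDegree_X_sub_C, mul_one]
  refine ⟨_, r, hq, hrm, ?_, hr, ?_, by omega⟩
  · exact (((irreducible_X_sub_C a).coprime_iff_not_dvd).2 hra).pow_left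
  · rw [(monic_X_sub_C a).natDegree_pow, natDegree_X_sub_C, mul_one]
    by_contra! hlt
    have hr1 : r = 1 := hrm.natDegree_eq_zero.1 (by omega)
    -- If `a` were the only root, the subleading coefficient would be `-(m + 2) * a`, which is
    -- nonzero.
    have hpe : p = (X + C (-a)) ^ (m + 2) := by
      rw [hr, hr1, mul_one, show e = m + 2 by rw [hr1, natDegree_one] at hdeg; omega, C_neg,
        sub_eq_add_neg]
    rw [hpe, coeff_X_add_C_pow] at h1
    simp only [Nat.add_sub_add_left, Nat.reduceSub, pow_one, mul_eq_zero, neg_eq_zero, hane,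
      Nat.cast_eq_zero, false_or] at h1
    exact absurd h1 (Nat.choose_pos (by omega)).ne'

/-! ### Vanishing orders of analytic functions -/

/-- A vanishing order `r < n` would leave a factor `g` with `g t₀ ≠ 0`, yet the bound forces `g` to
tend to zero. -/
theorem exists_eventuallyEq_pow_mul_of_abs_le {f : ℝ → ℝ} {t₀ : ℝ} (hf : AnalyticAt ℝ f t₀)
    {n : ℕ} {K : ℝ} (h : ∀ᶠ t in 𝓝 t₀, |f t| ≤ K * |t - t₀| ^ n) :
    ∃ g, AnalyticAt ℝ g t₀ ∧ ∀ᶠ t in 𝓝 t₀, f t = (t - t₀) ^ n * g t := by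
  have hord := natCast_le_analyticOrderAt hf (n := n)
  simp only [smul_eq_mul] at hord
  rw [← hord]
  by_contra! hlt
  obtain ⟨r, hr⟩ := ENat.ne_top_iff_exists.1 hlt.ne_top
  rw [← hr, Nat.cast_lt] at hlt
  obtain ⟨g, hg, hg0, hfg⟩ := hf.analyticOrderAt_eq_natCast.1 hr.symm
  have h1 : ∀ᶠ t in 𝓝[≠] t₀, |g t| ≤ K * |t - t₀| ^ (n - r) := by
    filter_upwards [h.filter_mono nhdsWithin_le_nhds, hfg.filter_mono nhdsWithin_le_nhds,
      self_mem_nhdsWithin] with t ht1 ht2 ht3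
    have hpos : 0 < |t - t₀| ^ r := pow_pos (abs_pos.2 (sub_ne_zero.2 ht3)) r
    rw [ht2, smul_eq_mul, abs_mul, abs_pow, show n = (n - r) + r by omega, pow_add]
      at ht1
    exact le_of_mul_le_mul_left (by linarith) hpos
  have h2 : Tendsto (fun t => K * |t - t₀| ^ (n - r)) (𝓝[≠] t₀) (𝓝 0) := by
    have : Continuous fun t : ℝ => K * |t - t₀| ^ (n - r) := by fun_prop
    have h3 := (this.tendsto t₀).mono_left (nhdsWithin_le_nhds (s := {t₀}ᶜ))
    simpa [show n - r ≠ 0 by omega] using h3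
  have h4 := le_of_tendsto_of_tendsto (hg.continuousAt.abs.mono_left nhdsWithin_le_nhds) h2 h1
  exact hg0 (abs_nonpos_iff.1 h4)

theorem eq_of_pow_mul_eventuallyEq {f g : ℝ → ℝ} {t₀ : ℝ} {n : ℕ} (hf : ContinuousAt f t₀)
    (hg : ContinuousAt g t₀) (h : ∀ᶠ t in 𝓝 t₀, (t - t₀) ^ n * f t = (t - t₀) ^ n * g t) :
    f t₀ = g t₀ := by
  refine tendsto_nhds_unique_of_eventuallyEq (l := 𝓝[≠] t₀) (hf.mono_left nhdsWithin_le_nhds)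
    (hg.mono_left nhdsWithin_le_nhds) ?_
  filter_upwards [h.filter_mono nhdsWithin_le_nhds, self_mem_nhdsWithin] with t ht1 ht2
  exact mul_left_cancel₀ (pow_ne_zero n (sub_ne_zero.2 ht2)) ht1

theorem even_of_pow_mul_nonneg {g : ℝ → ℝ} {t₀ : ℝ} {n : ℕ} (hg : ContinuousAt g t₀)
    (hg0 : g t₀ ≠ 0) (h : ∀ᶠ t in 𝓝 t₀, 0 ≤ (t - t₀) ^ n * g t) : Even n := by
  by_contra hn
  rw [Nat.not_even_iff_odd] at hn
  -- For odd `n` the product has the sign of `(t - t₀) * g t`; approaching from the right (`ε = 1`)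
  -- and from the left (`ε = -1`) gives opposite signs for `g t₀`.
  have key : ∀ s : Set ℝ, (𝓝[s] t₀).NeBot → ∀ ε : ℝ, (∀ t ∈ s, 0 < ε * (t - t₀)) → 0 ≤ ε * g t₀ := by
    intro s hs ε hε
    refine ge_of_tendsto ((hg.mono_left (nhdsWithin_le_nhds (s := s))).const_mul ε) ?_
    filter_upwards [h.filter_mono nhdsWithin_le_nhds, self_mem_nhdsWithin] with t ht1 ht2
    have h1 := hε t ht2
    have h2 : 0 < (ε * (t - t₀)) ^ n := pow_pos h1 n
    obtain ⟨k, rfl⟩ := hn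
    have hε2 : 0 < ε ^ (2 * k) * (t - t₀) ^ (2 * k) * (ε * (t - t₀)) := by
      rw [← mul_pow, ← pow_succ]; exact h2
    have hpos : 0 < (t - t₀) ^ (2 * k) * (t - t₀) ^ 2 := by
      have : t - t₀ ≠ 0 := fun h => by simp [h] at h1
      have h3 : 0 < (t - t₀) ^ 2 := by positivity
      rw [pow_mul]
      positivity
    have h5 : 0 ≤ ((t - t₀) ^ (2 * k) * (t - t₀) ^ 2) * (ε * g t) := by
      have := mul_nonneg h1.le ht1
      calc 0 ≤ _ := this
        _ = _ := by ring
    exact nonneg_of_mul_nonneg_right h5 hpos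
  have h1 := key (Set.Ioi t₀) inferInstance 1 fun t ht => by simpa using ht
  have h2 := key (Set.Iio t₀) inferInstance (-1) fun t ht => by simpa using ht
  exact hg0 (by linarith)

/-! ### Rellich's theorem: local analytic roots -/

/-- Near `t₀`, the polynomials `p t` are products of linear factors with analytic roots. -/
def HasAnalyticRootsAt (p : ℝ → ℝ[X]) (t₀ : ℝ) : Prop :=
  ∃ s : Multiset (ℝ → ℝ), (∀ f ∈ s, AnalyticAt ℝ f t₀) ∧
    ∀ᶠ t in 𝓝 t₀, p t = (s.map fun f => X - C (f t)).prod

namespace HasAnalyticRootsAt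

variable {p q r : ℝ → ℝ[X]} {t₀ : ℝ}

theorem mul (hq : HasAnalyticRootsAt q t₀) (hr : HasAnalyticRootsAt r t₀)
    (h : ∀ᶠ t in 𝓝 t₀, p t = q t * r t) : HasAnalyticRootsAt p t₀ := by
  obtain ⟨s, hs, hqs⟩ := hq
  obtain ⟨s', hs', hrs⟩ := hr
  refine ⟨s + s', fun f hf => (Multiset.mem_add.1 hf).elim (hs f) (hs' f), ?_⟩
  filter_upwards [h, hqs, hrs] with t h1 h2 h3
  rw [h1, h2, h3, Multiset.map_add, Multiset.prod_add]

theorem of_scaleRoots (hq : HasAnalyticRootsAt q t₀) {c : ℝ → ℝ} (hc : AnalyticAt ℝ c t₀)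
    (h : ∀ᶠ t in 𝓝 t₀, p t = (q t).scaleRoots (c t)) : HasAnalyticRootsAt p t₀ := by
  obtain ⟨s, hs, hqs⟩ := hq
  refine ⟨s.map fun f t => f t * c t, fun f hf => ?_, ?_⟩
  · obtain ⟨g, hg, rfl⟩ := Multiset.mem_map.1 hf
    exact (hs g hg).mul hc
  filter_upwards [h, hqs] with t h1 h2
  rw [h1, h2, Multiset.map_map]
  clear hs hqs h2
  induction s using Multiset.induction with
  | empty => simp
  | cons a s ih =>
    simp only [Multiset.map_cons, Multiset.prod_cons] at ih ⊢
    rw [mul_scaleRoots_of_noZeroDivisors, ih, X_sub_C_scaleRoots]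
    simp [mul_comm]

theorem of_taylor {a : ℝ → ℝ} (ha : AnalyticAt ℝ a t₀)
    (h : HasAnalyticRootsAt (fun t => taylor (a t) (p t)) t₀) : HasAnalyticRootsAt p t₀ := by
  obtain ⟨s, hs, hps⟩ := h
  refine ⟨s.map fun f t => f t + a t, fun f hf => ?_, ?_⟩
  · obtain ⟨g, hg, rfl⟩ := Multiset.mem_map.1 hf
    exact (hs g hg).add ha
  filter_upwards [hps] with t ht
  have h1 : p t = taylor (-a t) (taylor (a t) (p t)) := by
    rw [taylor_taylor, neg_add_cancel, taylor_zero]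
  rw [h1, ht, Multiset.map_map]
  clear hs hps ht h1
  induction s using Multiset.induction with
  | empty => simp
  | cons b s ih =>
    simp only [Multiset.map_cons, Multiset.prod_cons] at ih ⊢
    rw [taylor_mul, ih]
    congr 1
    simp [taylor_apply]
    ring

end HasAnalyticRootsAt

theorem analyticAt_coeff_taylor {p : ℝ → ℝ[X]} {t₀ : ℝ} {m : ℕ} {a : ℝ → ℝ}
    (hd : ∀ t, (p t).natDegree = m) (hp : ∀ i, AnalyticAt ℝ (fun t => (p t).coeff i) t₀)
    (ha : AnalyticAt ℝ a t₀) (i : ℕ) :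
    AnalyticAt ℝ (fun t => (taylor (a t) (p t)).coeff i) t₀ := by
  have h : ∀ t, (taylor (a t) (p t)).coeff i =
      ∑ j ∈ Finset.range (m + 1), (p t).coeff j * (a t ^ (j - i) * (j.choose i : ℝ)) := by
    intro t
    conv_lhs => rw [(p t).as_sum_range_C_mul_X_pow]
    simp [taylor_apply, hd, coeff_X_add_C_pow]
  simp only [h]
  exact Finset.analyticAt_fun_sum _ fun j _ => (hp j).mul ((ha.pow _).mul analyticAt_const)

theorem coeff_taylor_pred {p : ℝ[X]} {m : ℕ} (hp : p.Monic) (hd : p.natDegree = m + 1) (a : ℝ) :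
    (taylor a p).coeff m = p.coeff m + (m + 1) * a := by
  have h1 : p.coeff (m + 1) = 1 := hd ▸ hp.coeff_natDegree
  conv_lhs => rw [p.as_sum_range_C_mul_X_pow]
  simp only [hd, taylor_apply, sum_comp, mul_comp, C_comp, X_pow_comp, finsetSum_coeff,
    coeff_C_mul, coeff_X_add_C_pow]
  rw [Finset.sum_range_succ, Finset.sum_range_succ, Finset.sum_eq_zero fun x hx => ?_]
  · simp [h1]; ring
  · rw [Nat.choose_eq_zero_of_lt (Finset.mem_range.1 hx)]; simp

/-- Real-rooted monic polynomials with centred roots factor after scaling the roots by a power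
of `t - t₀`. -/
theorem exists_scaleRoots_of_coeff_pred_eq_zero {p : ℝ → ℝ[X]} {t₀ : ℝ} {m : ℕ}
    (hm : ∀ t, (p t).Monic) (hd : ∀ t, (p t).natDegree = m + 2)
    (ha : ∀ i, AnalyticAt ℝ (fun t => (p t).coeff i) t₀) (hs : ∀ᶠ t in 𝓝 t₀, (p t).Splits)
    (h1 : ∀ t, (p t).coeff (m + 1) = 0) (h0 : ¬ ∀ᶠ t in 𝓝 t₀, (p t).coeff m = 0) :
    ∃ (k : ℕ) (q : ℝ → ℝ[X]), (∀ t, (q t).Monic) ∧ (∀ t, (q t).natDegree = m + 2) ∧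
      (∀ i, AnalyticAt ℝ (fun t => (q t).coeff i) t₀) ∧ (∀ᶠ t in 𝓝 t₀, (q t).Splits) ∧
      (q t₀).coeff (m + 1) = 0 ∧ (q t₀).coeff m ≠ 0 ∧
      ∀ᶠ t in 𝓝 t₀, p t = (q t).scaleRoots ((t - t₀) ^ k) := by
  obtain ⟨n, g, hg, hg0, hpg⟩ := (ha m).exists_eventuallyEq_pow_smul_nonzero_iff.2 h0
  simp only [smul_eq_mul] at hpg
  have hroot : ∀ᶠ t in 𝓝 t₀, ∀ x ∈ (p t).roots, x ^ 2 ≤ -2 * (p t).coeff m :=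
    hs.mono fun t ht x hx => sq_root_le (hm t) ht (hd t) (h1 t) hx
  have hnonneg : ∀ᶠ t in 𝓝 t₀, 0 ≤ (t - t₀) ^ n * (-g t) := by
    filter_upwards [hs, hroot, hpg] with t h2 h3 h4
    obtain ⟨x, hx⟩ := Multiset.exists_mem_of_ne_zero (h2.roots_ne_zero (by rw [hd]; omega))
    nlinarith [h3 x hx, sq_nonneg x]
  -- The coefficient is minus half a sum of squares, so its order is even; half of it is the scaling
  -- exponent.
  obtain ⟨k, rfl⟩ := even_of_pow_mul_nonneg hg.continuousAt.neg (neg_ne_zero.2 hg0) hnonneg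
  obtain ⟨K, hK0, hK⟩ : ∃ K : ℝ, 0 ≤ K ∧ ∀ᶠ t in 𝓝 t₀, 2 * |g t| ≤ K ^ 2 := by
    -- Since `2 * c < (2 * c + 1) ^ 2` for `c ≥ 0`, the inequality is strict at `t₀` and persists
    -- nearby.
    refine ⟨2 * |g t₀| + 1, by positivity, ?_⟩
    have : ∀ᶠ t in 𝓝 t₀, 2 * |g t| < (2 * |g t₀| + 1) ^ 2 :=
      (hg.continuousAt.abs.const_mul 2).eventually_lt continuousAt_const
        (by nlinarith [abs_nonneg (g t₀)])
    exact this.mono fun t ht => ht.le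
  have hbd : ∀ᶠ t in 𝓝 t₀, ∀ x ∈ (p t).roots, |x| ≤ K * |t - t₀| ^ k := by
    filter_upwards [hroot, hpg, hK] with t h2 h3 h4 x hx
    refine abs_le_of_sq_le_sq ?_ (by positivity)
    have h5 := h2 x hx
    rw [h3, ← two_mul, pow_mul'] at h5
    have h6 : (K * |t - t₀| ^ k) ^ 2 = K ^ 2 * ((t - t₀) ^ k) ^ 2 := by
      rw [mul_pow, ← abs_pow, sq_abs]
    rw [h6]
    nlinarith [neg_abs_le (g t), sq_nonneg ((t - t₀) ^ k)]
  -- Coefficient `i` is, up to sign, the elementary symmetric function of degree `m + 2 - i` in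
  -- roots of size `O(|t - t₀| ^ k)`. The power extracted is exactly the one `scaleRoots` restores.
  have hcoeff : ∀ i, ∃ b, AnalyticAt ℝ b t₀ ∧
      ∀ᶠ t in 𝓝 t₀, (p t).coeff i = (t - t₀) ^ (k * (m + 2 - i)) * b t := by
    intro i
    refine exists_eventuallyEq_pow_mul_of_abs_le (ha i)
      (K := K ^ (m + 2 - i) * ((m + 2).choose i : ℝ)) ?_
    filter_upwards [hbd, hs] with t h2 h3
    have h4 := coeff_le_of_roots_le (f := RingHom.id ℝ) (p := p t) i (hm t) (by simpa using h3)
      (B := K * |t - t₀| ^ k) (by simpa using h2)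
    rw [Polynomial.map_id, hd, Real.norm_eq_abs, mul_pow, ← pow_mul] at h4
    linarith
  choose b hb hpb using hcoeff
  let q : ℝ → ℝ[X] := fun t => X ^ (m + 2) + lowPoly (m + 2) fun i => b i t
  have hqm : ∀ t, (q t).Monic := fun t => monic_X_pow_add_lowPoly _ _
  have hqd : ∀ t, (q t).natDegree = m + 2 := fun t => natDegree_X_pow_add_lowPoly _ _
  have hqc : ∀ t i, i < m + 2 → (q t).coeff i = b i t := by
    intro t i hi
    simp [q, coeff_X_pow, hi.ne, coeff_lowPoly _ hi]
  have hqa : ∀ i, AnalyticAt ℝ (fun t => (q t).coeff i) t₀ := fun i =>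
    (analyticAt_coeff_lowPoly (m + 2) i _).comp
      (analyticAt_pi_iff.2 fun j : Fin (m + 2) => hb j)
  have hpq : ∀ᶠ t in 𝓝 t₀, p t = (q t).scaleRoots ((t - t₀) ^ k) := by
    have hall : ∀ᶠ t in 𝓝 t₀, ∀ i ∈ Finset.range (m + 2),
        (p t).coeff i = (t - t₀) ^ (k * (m + 2 - i)) * b i t :=
      (Filter.eventually_all_finset _).2 fun i _ => hpb i
    filter_upwards [hall] with t ht
    ext i
    rw [coeff_scaleRoots, hqd, ← pow_mul]
    rcases lt_trichotomy i (m + 2) with hi | rfl | hi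
    · rw [ht i (Finset.mem_range.2 hi), hqc t i hi, mul_comm]
    · have h2 := (hm t).coeff_natDegree
      have h3 := (hqm t).coeff_natDegree
      rw [hd] at h2
      rw [hqd] at h3
      simp [h2, h3]
    · rw [coeff_eq_zero_of_natDegree_lt (by rwa [hd]),
        coeff_eq_zero_of_natDegree_lt (by rwa [hqd]), zero_mul]
  -- Off `t₀` the scaling can be undone; at `t₀` itself real-rootedness passes to the limit.
  have hqs : ∀ᶠ t in 𝓝[≠] t₀, (q t).Splits := by
    filter_upwards [hs.filter_mono nhdsWithin_le_nhds, hpq.filter_mono nhdsWithin_le_nhds,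
      self_mem_nhdsWithin] with t h2 h3 h4
    have h5 : (t - t₀) ^ k ≠ 0 := pow_ne_zero _ (sub_ne_zero.2 h4)
    have h6 := h2.scaleRoots ((t - t₀) ^ k)⁻¹
    rwa [h3, ← scaleRoots_mul, mul_inv_cancel₀ h5, scaleRoots_one] at h6
  have hqs0 : (q t₀).Splits := splits_of_tendsto hqm (fun t => by rw [hqd, hqd]) (hqm t₀) hqs
    fun i => (hqa i).continuousAt.mono_left nhdsWithin_le_nhds
  refine ⟨k, q, hqm, hqd, hqa, ?_, ?_, ?_, hpq⟩
  · rw [eventually_nhdsWithin_iff] at hqs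
    filter_upwards [hqs] with t ht
    by_cases h : t = t₀
    · exact h ▸ hqs0
    · exact ht h
  · rw [hqc _ _ (by omega)]
    refine eq_of_pow_mul_eventuallyEq (g := 0) (n := k * (m + 2 - (m + 1)))
      (hb _).continuousAt continuousAt_const ?_
    filter_upwards [hpb (m + 1)] with t ht
    rw [← ht, h1]; simp
  · rw [hqc _ _ (by omega)]
    have := eq_of_pow_mul_eventuallyEq (g := g) (n := k + k)
      (hb m).continuousAt hg.continuousAt ?_
    · rwa [this]
    filter_upwards [hpb m, hpg] with t h2 h3
    rw [← h3, h2, show m + 2 - m = 2 by omega, mul_two]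

/-- Rellich's theorem for polynomials: a real-rooted monic polynomial whose coefficients are
analytic near `t₀` has analytic roots near `t₀`. -/
theorem hasAnalyticRootsAt {p : ℝ → ℝ[X]} {t₀ : ℝ} {m : ℕ} (hm : ∀ t, (p t).Monic)
    (hd : ∀ t, (p t).natDegree = m) (ha : ∀ i, AnalyticAt ℝ (fun t => (p t).coeff i) t₀)
    (hs : ∀ᶠ t in 𝓝 t₀, (p t).Splits) : HasAnalyticRootsAt p t₀ := by
  induction m using Nat.strong_induction_on generalizing p with
  | _ m ih =>
  match m with
  | 0 => exact ⟨0, by simp, .of_forall fun t => by simpa using (hm t).natDegree_eq_zero.1 (hd t)⟩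
  | 1 =>
    refine ⟨{fun t => -(p t).coeff 0}, fun f hf => ?_, .of_forall fun t => ?_⟩
    · rw [Multiset.mem_singleton.1 hf]
      exact (ha 0).neg
    · simpa using (hm t).eq_X_add_C (hd t)
  | m + 2 =>
    -- The mean of the roots; translating by it kills the subleading coefficient.
    let a : ℝ → ℝ := fun t => -(p t).coeff (m + 1) * (m + 2 : ℝ)⁻¹
    have haa : AnalyticAt ℝ a t₀ := (ha (m + 1)).neg.mul analyticAt_const
    refine .of_taylor haa ?_
    have hm' : ∀ t, (taylor (a t) (p t)).Monic := fun t => by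
      rw [taylor_apply]; exact (hm t).comp_X_add_C _
    have hd' : ∀ t, (taylor (a t) (p t)).natDegree = m + 2 := fun t => by
      rw [natDegree_taylor, hd]
    have hs' : ∀ᶠ t in 𝓝 t₀, (taylor (a t) (p t)).Splits := hs.mono fun t ht => ht.taylor _
    have h1 : ∀ t, (taylor (a t) (p t)).coeff (m + 1) = 0 := fun t => by
      rw [coeff_taylor_pred (hm t) (hd t)]
      simp only [a]
      have : (m + 2 : ℝ) ≠ 0 := by positivity
      push_cast
      field_simp
      ring
    have ha' := analyticAt_coeff_taylor hd ha haa
    generalize hP : (fun t => taylor (a t) (p t)) = P at *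
    have hP' : ∀ t, taylor (a t) (p t) = P t := fun t => congrFun hP t
    simp only [hP'] at hm' hd' hs' h1 ha'
    by_cases h0 : ∀ᶠ t in 𝓝 t₀, (P t).coeff m = 0
    · refine ⟨Multiset.replicate (m + 2) 0, fun f hf => ?_, ?_⟩
      · rw [Multiset.eq_of_mem_replicate hf]; exact analyticAt_const
      filter_upwards [h0, hs'] with t h2 h3
      rw [eq_X_pow_of_forall_roots_eq_zero (hm' t) h3 fun x hx => ?_, hd']
      · simp only [Multiset.map_replicate, Multiset.prod_replicate, Pi.zero_apply, C_0, sub_zero]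
      · have := sq_root_le (hm' t) h3 (hd' t) (h1 t) hx
        rw [h2] at this
        exact pow_eq_zero_iff two_ne_zero |>.1 (le_antisymm (by linarith) (sq_nonneg x))
    · obtain ⟨k, q, hqm, hqd, hqa, hqs, hq1, hq0, hPq⟩ :=
        exists_scaleRoots_of_coeff_pred_eq_zero hm' hd' ha' hs' h1 h0
      refine .of_scaleRoots ?_ ((analyticAt_id.sub analyticAt_const).pow k) hPq
      obtain ⟨q₀, r₀, hq₀, hr₀, hc, hqr, hqlt, hrlt⟩ :=
        exists_coprime_factorization (hqm t₀) hqs.self_of_nhds (hqd t₀) hq1 hq0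
      rw [hqd] at hqlt hrlt
      obtain ⟨Q, R, hQm, hRm, hQd, hRd, hQa, hRa, hQR⟩ :=
        exists_analytic_factorization hqm hqd hqa hq₀ hr₀ hc hqr
      refine .mul (ih _ hqlt hQm hQd hQa ?_) (ih _ hrlt hRm hRd hRa ?_) hQR
      · filter_upwards [hQR, hqs] with t h2 h3
        exact h3.of_dvd (hqm t).ne_zero ⟨_, h2⟩
      · filter_upwards [hQR, hqs] with t h2 h3
        exact h3.of_dvd (hqm t).ne_zero ⟨_, h2.trans (mul_comm _ _)⟩

/-! ### Continuation of an analytic root to the whole line -/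

open Set

/-- `f` is an analytic choice of a root of `p t` for `t ∈ U`. -/
def IsAnalyticRootOn (p : ℝ → ℝ[X]) (f : ℝ → ℝ) (U : Set ℝ) : Prop :=
  AnalyticOnNhd ℝ f U ∧ ∀ t ∈ U, (p t).eval (f t) = 0

theorem IsAnalyticRootOn.mono {p : ℝ → ℝ[X]} {f : ℝ → ℝ} {U V : Set ℝ}
    (h : IsAnalyticRootOn p f V) (hUV : U ⊆ V) : IsAnalyticRootOn p f U :=
  ⟨h.1.mono hUV, fun t ht => h.2 t (hUV ht)⟩

theorem IsAnalyticRootOn.congr {p : ℝ → ℝ[X]} {f g : ℝ → ℝ} {U : Set ℝ} (hU : IsOpen U)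
    (h : IsAnalyticRootOn p f U) (hfg : EqOn f g U) : IsAnalyticRootOn p g U :=
  ⟨h.1.congr hU hfg, fun t ht => hfg ht ▸ h.2 t ht⟩

theorem IsAnalyticRootOn.union {p : ℝ → ℝ[X]} {f g : ℝ → ℝ} {U V : Set ℝ} (hU : IsOpen U)
    (hV : IsOpen V) (hf : IsAnalyticRootOn p f U) (hg : IsAnalyticRootOn p g V)
    (hfg : EqOn f g (U ∩ V)) :
    ∃ h, IsAnalyticRootOn p h (U ∪ V) ∧ EqOn h f U := by
  classical
  have h1 : EqOn (U.piecewise f g) f U := piecewise_eqOn U f g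
  have h2 : EqOn (U.piecewise f g) g V := fun t ht => by
    by_cases htU : t ∈ U
    · rw [h1 htU, hfg ⟨htU, ht⟩]
    · rw [piecewise_eq_of_notMem _ _ _ htU]
  have hf' := hf.congr hU h1.symm
  have hg' := hg.congr hV h2.symm
  refine ⟨U.piecewise f g, ⟨fun t ht => ?_, fun t ht => ?_⟩, h1⟩
  · exact ht.elim (hf'.1 t) (hg'.1 t)
  · exact ht.elim (hf'.2 t) (hg'.2 t)

/-- Near any point, an analytic root on a small interval extends to an interval of fixed size. -/
def HasLocalRootExtension (p : ℝ → ℝ[X]) : Prop :=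
  ∀ t₀, ∃ ε > 0, ∀ a b f, a < b → Ioo a b ⊆ Ioo (t₀ - ε) (t₀ + ε) →
    IsAnalyticRootOn p f (Ioo a b) →
    ∃ g, IsAnalyticRootOn p g (Ioo (t₀ - ε) (t₀ + ε)) ∧ EqOn f g (Ioo a b)

/-- Near `t₀` a root takes its values among finitely many analytic functions, so it agrees
frequently with one of them at some point, and the identity theorem makes them equal on the
interval. -/
theorem hasLocalRootExtension {p : ℝ → ℝ[X]} (h : ∀ t, HasAnalyticRootsAt p t) :
    HasLocalRootExtension p := by
  intro t₀
  obtain ⟨s, hs, hps⟩ := h t₀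
  have hs' : ∀ᶠ t in 𝓝 t₀, ∀ f ∈ s, AnalyticAt ℝ f t := by
    classical
    have := (Filter.eventually_all_finset s.toFinset (l := 𝓝 t₀)
      (p := fun f t => AnalyticAt ℝ f t)).2
      fun f hf => (hs f (Multiset.mem_toFinset.1 hf)).eventually_analyticAt
    simpa using this
  obtain ⟨ε, hε, hball⟩ := Metric.eventually_nhds_iff_ball.1 (hs'.and hps)
  rw [Real.ball_eq_Ioo] at hball
  refine ⟨ε, hε, fun a b f hab hsub hf => ?_⟩
  obtain ⟨g, hg, t₁, ht₁, hfr⟩ : ∃ g ∈ s, ∃ t₁ ∈ Ioo a b, ∃ᶠ t in 𝓝[≠] t₁, f t = g t := by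
    by_contra! hcon
    obtain ⟨t₁, ht₁⟩ := nonempty_Ioo.2 hab
    have h1 : ∀ᶠ t in 𝓝[≠] t₁, ∀ g ∈ s, f t ≠ g t := by
      classical
      have := (Filter.eventually_all_finset s.toFinset (l := 𝓝[≠] t₁)
        (p := fun g t => f t ≠ g t)).2
        fun g hg => (hcon g (Multiset.mem_toFinset.1 hg) t₁ ht₁)
      simpa using this
    have h2 : ∀ᶠ t in 𝓝[≠] t₁, t ∈ Ioo a b :=
      nhdsWithin_le_nhds (isOpen_Ioo.mem_nhds ht₁)
    obtain ⟨t, h3, h4⟩ := (h1.and h2).exists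
    have h5 := hf.2 t h4
    rw [(hball t (hsub h4)).2, eval_multiset_prod, Multiset.map_map, Multiset.prod_eq_zero_iff,
      Multiset.mem_map] at h5
    obtain ⟨g, hg, hg0⟩ := h5
    exact h3 g hg (sub_eq_zero.1 (by simpa using hg0))
  refine ⟨g, ⟨fun t ht => (hball t ht).1 g hg, fun t ht => ?_⟩, ?_⟩
  · rw [(hball t ht).2, eval_multiset_prod, Multiset.map_map, Multiset.prod_eq_zero_iff,
      Multiset.mem_map]
    exact ⟨g, hg, by simp⟩
  · exact hf.1.eqOn_of_preconnected_of_frequently_eq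
      (fun t ht => (hball t (hsub ht)).1 g hg) isPreconnected_Ioo ht₁ hfr

theorem HasLocalRootExtension.extend_right {p : ℝ → ℝ[X]} (h : HasLocalRootExtension p) (b : ℝ) :
    ∃ ε > 0, ∀ a c f, a < c → b - ε < c → c ≤ b → IsAnalyticRootOn p f (Ioo a c) →
      ∃ g, IsAnalyticRootOn p g (Ioo a (b + ε)) ∧ EqOn g f (Ioo a c) := by
  obtain ⟨ε, hε, H⟩ := h b
  refine ⟨ε, hε, fun a c f hac hbc hcb hf => ?_⟩
  obtain ⟨g, hg, hfg⟩ := H (max a (b - ε)) c f (max_lt hac hbc)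
    (Ioo_subset_Ioo (le_max_right _ _) (by linarith))
    (hf.mono (Ioo_subset_Ioo_left (le_max_left _ _)))
  obtain ⟨k, hk, hkf⟩ := hf.union isOpen_Ioo isOpen_Ioo hg (fun t ht =>
    hfg ⟨max_lt ht.1.1 ht.2.1, ht.1.2⟩)
  refine ⟨k, hk.mono fun t ht => ?_, hkf⟩
  rcases lt_or_ge t c with htc | htc
  · exact Or.inl ⟨ht.1, htc⟩
  · exact Or.inr ⟨by linarith, ht.2⟩

theorem HasLocalRootExtension.extend_left {p : ℝ → ℝ[X]} (h : HasLocalRootExtension p) (a : ℝ) :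
    ∃ ε > 0, ∀ b c f, c < b → c < a + ε → a ≤ c → IsAnalyticRootOn p f (Ioo c b) →
      ∃ g, IsAnalyticRootOn p g (Ioo (a - ε) b) ∧ EqOn g f (Ioo c b) := by
  obtain ⟨ε, hε, H⟩ := h a
  refine ⟨ε, hε, fun b c f hcb hca hac hf => ?_⟩
  obtain ⟨g, hg, hfg⟩ := H c (min b (a + ε)) f (lt_min hcb hca)
    (Ioo_subset_Ioo (by linarith) (min_le_right _ _))
    (hf.mono (Ioo_subset_Ioo_right (min_le_left _ _)))
  obtain ⟨k, hk, hkf⟩ := hf.union isOpen_Ioo isOpen_Ioo hg (fun t ht =>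
    hfg ⟨ht.1.1, lt_min ht.1.2 ht.2.2⟩)
  refine ⟨k, hk.mono fun t ht => ?_, hkf⟩
  rcases lt_or_ge c t with htc | htc
  · exact Or.inl ⟨htc, ht.2⟩
  · exact Or.inr ⟨ht.1, by linarith⟩

theorem HasLocalRootExtension.extend_both {p : ℝ → ℝ[X]} (h : HasLocalRootExtension p) {r : ℝ}
    {f : ℝ → ℝ} (hr : 0 < r) (hf : IsAnalyticRootOn p f (Ioo (-r) r)) (R : ℝ) :
    ∃ g, IsAnalyticRootOn p g (Ioo (-R) R) ∧ EqOn g f (Ioo (-r) r ∩ Ioo (-R) R) := by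
  let S : Set ℝ := {R | r ≤ R ∧ ∃ g, IsAnalyticRootOn p g (Ioo (-R) R) ∧ EqOn g f (Ioo (-r) r)}
  have hrS : r ∈ S := ⟨le_rfl, f, hf, fun _ _ => rfl⟩
  by_cases hbdd : BddAbove S
  · exfalso
    set b := sSup S
    have hrb : r ≤ b := le_csSup hbdd hrS
    obtain ⟨ε₁, hε₁, H₁⟩ := h.extend_right b
    obtain ⟨ε₂, hε₂, H₂⟩ := h.extend_left (-b)
    -- Taking `c` within both extension widths of the supremum lets the root pass `b` on the right
    -- and `-b` on the left, a contradiction.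
    obtain ⟨c, ⟨hrc, g, hg, hgf⟩, hc⟩ := exists_lt_of_lt_csSup ⟨r, hrS⟩
      (show b - min ε₁ ε₂ < b by linarith [lt_min hε₁ hε₂])
    have hcb : c ≤ b := le_csSup hbdd ⟨hrc, g, hg, hgf⟩
    have hm₁ := min_le_left ε₁ ε₂
    have hm₂ := min_le_right ε₁ ε₂
    obtain ⟨g₁, hg₁, hg₁g⟩ := H₁ (-c) c g (by linarith) (by linarith) hcb hg
    obtain ⟨g₂, hg₂, hg₂g⟩ := H₂ (b + ε₁) (-c) g₁ (by linarith) (by linarith) (by linarith) hg₁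
    have hmem : b + min ε₁ ε₂ ∈ S := by
      refine ⟨by linarith [lt_min hε₁ hε₂], g₂,
        hg₂.mono (Ioo_subset_Ioo (by linarith) (by linarith)), fun t ht => ?_⟩
      have h1 : t ∈ Ioo (-c) c := ⟨by linarith [ht.1], by linarith [ht.2]⟩
      rw [hg₂g ⟨h1.1, by linarith [h1.2]⟩, hg₁g h1, hgf ht]
    have := le_csSup hbdd hmem
    linarith [lt_min hε₁ hε₂]
  · obtain ⟨R', ⟨-, g, hg, hgf⟩, hR'⟩ := not_bddAbove_iff.1 hbdd R
    exact ⟨g, hg.mono (Ioo_subset_Ioo (by linarith) hR'.le), hgf.mono inter_subset_left⟩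

theorem HasLocalRootExtension.exists_global {p : ℝ → ℝ[X]} (h : HasLocalRootExtension p) {r : ℝ}
    {f : ℝ → ℝ} (hr : 0 < r) (hf : IsAnalyticRootOn p f (Ioo (-r) r)) :
    ∃ g, IsAnalyticRootOn p g univ := by
  choose F hF hFf using h.extend_both hr hf
  have hF_eq : ∀ R R', 0 < R → R ≤ R' → EqOn (F R) (F R') (Ioo (-R) R) := by
    intro R R' hR hRR'
    have hsub : Ioo (-R) R ⊆ Ioo (-R') R' := Ioo_subset_Ioo (by linarith) hRR'
    refine (hF R).1.eqOn_of_preconnected_of_eventuallyEq ((hF R').1.mono hsub) isPreconnected_Ioo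
      (z₀ := 0) ⟨by linarith, hR⟩ ?_
    have hmem : Ioo (-r) r ∩ Ioo (-R) R ∈ 𝓝 (0 : ℝ) :=
      inter_mem (Ioo_mem_nhds (by linarith) hr) (Ioo_mem_nhds (by linarith) hR)
    filter_upwards [hmem] with t ht
    rw [hFf R ht, hFf R' ⟨ht.1, hsub ht.2⟩]
  -- The extensions `F R` are mutually compatible, so evaluating at `t` the one of radius `|t| + 1`
  -- glues them.
  have hG : ∀ R, 0 < R → EqOn (F R) (fun t => F (|t| + 1) t) (Ioo (-R) R) := by
    intro R hR t ht
    have ht' : t ∈ Ioo (-(|t| + 1)) (|t| + 1) :=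
      ⟨by linarith [neg_abs_le t], by linarith [le_abs_self t]⟩
    rcases le_total R (|t| + 1) with hle | hle
    · exact hF_eq R _ hR hle ht
    · exact (hF_eq _ R (by positivity) hle ht').symm
  refine ⟨fun t => F (|t| + 1) t, fun t _ => ?_, fun t _ => ?_⟩
  all_goals
    have hR : 0 < |t| + 1 := by positivity
    have ht' : t ∈ Ioo (-(|t| + 1)) (|t| + 1) :=
      ⟨by linarith [neg_abs_le t], by linarith [le_abs_self t]⟩
    have hroot := (hF _).congr isOpen_Ioo (hG _ hR)
  · exact hroot.1 t ht'
  · exact hroot.2 t ht'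

/-- A real-rooted monic polynomial of positive degree with analytic coefficients on the real line
has an analytic root on the real line. -/
theorem exists_analytic_root {p : ℝ → ℝ[X]} {m : ℕ} (hm : ∀ t, (p t).Monic)
    (hd : ∀ t, (p t).natDegree = m) (hm0 : m ≠ 0)
    (ha : ∀ i t₀, AnalyticAt ℝ (fun t => (p t).coeff i) t₀) (hs : ∀ t, (p t).Splits) :
    ∃ f : ℝ → ℝ, AnalyticOnNhd ℝ f univ ∧ ∀ t, (p t).eval (f t) = 0 := by
  have hloc : ∀ t, HasAnalyticRootsAt p t := fun t =>
    hasAnalyticRootsAt hm hd (fun i => ha i t) (.of_forall hs)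
  obtain ⟨s, hsa, hps⟩ := hloc 0
  obtain ⟨f, hf⟩ : ∃ f, f ∈ s := by
    refine Multiset.exists_mem_of_ne_zero fun h => hm0 ?_
    rw [← hd 0, hps.self_of_nhds, h]
    simp
  obtain ⟨r, hr, hball⟩ := Metric.eventually_nhds_iff_ball.1
    ((hsa f hf).eventually_analyticAt.and hps)
  rw [Real.ball_eq_Ioo, zero_sub, zero_add] at hball
  have hroot : IsAnalyticRootOn p f (Ioo (-r) r) := by
    refine ⟨fun t ht => (hball t ht).1, fun t ht => ?_⟩
    rw [(hball t ht).2, eval_multiset_prod, Multiset.map_map, Multiset.prod_eq_zero_iff,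
      Multiset.mem_map]
    exact ⟨f, hf, by simp⟩
  obtain ⟨g, hg⟩ := (hasLocalRootExtension hloc).exists_global hr hroot
  exact ⟨g, hg.1, fun t => hg.2 t (mem_univ t)⟩

/-! ### Analytic eigenvectors from analytic eigenvalues -/

/-- The algebra of real-analytic functions on the real line. -/
def analyticSubalgebra : Subalgebra ℝ (ℝ → ℝ) where
  carrier := {f | AnalyticOnNhd ℝ f univ}
  mul_mem' hf hg := hf.mul hg
  add_mem' hf hg := hf.add hg
  algebraMap_mem' _ := analyticOnNhd_const

namespace analyticSubalgebra

instance : IsDomain analyticSubalgebra := by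
  have : NoZeroDivisors analyticSubalgebra := by
    refine ⟨fun {f g} h => ?_⟩
    have h' : ∀ t ∈ (univ : Set ℝ), f.1 t * g.1 t = 0 := fun t _ => congrFun (congrArg Subtype.val h) t
    rcases AnalyticOnNhd.eq_zero_or_eq_zero_of_mul_eq_zero f.2 g.2 h' isPreconnected_univ with h0 | h0
    · exact Or.inl (Subtype.ext (funext fun t => h0 t (mem_univ t)))
    · exact Or.inr (Subtype.ext (funext fun t => h0 t (mem_univ t)))
  exact NoZeroDivisors.to_isDomain _

/-- Evaluation of analytic functions at a point. -/
def evalHom (t : ℝ) : analyticSubalgebra →+* ℝ :=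
  (Pi.evalRingHom (fun _ : ℝ => ℝ) t).comp analyticSubalgebra.val.toRingHom

theorem ext_eval {f g : analyticSubalgebra} (h : ∀ t, evalHom t f = evalHom t g) : f = g :=
  Subtype.ext (funext h)

/-- The coordinate function. -/
def coord : analyticSubalgebra := ⟨fun t => t, fun _ _ => analyticAt_id⟩

noncomputable instance : Algebra ℝ[X] analyticSubalgebra := (aeval coord).toAlgebra

theorem evalHom_algebraMap (t : ℝ) (q : ℝ[X]) :
    evalHom t (algebraMap ℝ[X] analyticSubalgebra q) = q.eval t := by
  change evalHom t (aeval coord q) = _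
  rw [aeval_def, hom_eval₂]
  exact congrArg (fun f => eval₂ f t q) (RingHom.ext fun x => rfl)

end analyticSubalgebra

open analyticSubalgebra Matrix

theorem exists_eq_sub_mul_of_eq_zero {f : ℝ → ℝ} (hf : AnalyticOnNhd ℝ f univ) {t₀ : ℝ}
    (h0 : f t₀ = 0) : ∃ g, AnalyticOnNhd ℝ g univ ∧ ∀ t, f t = (t - t₀) * g t := by
  refine ⟨dslope f t₀, fun t _ => ?_, fun t => ?_⟩
  · by_cases h : t = t₀
    · subst h
      obtain ⟨p, hp⟩ := hf t (mem_univ t)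
      exact hp.has_fpower_series_dslope_fslope.analyticAt
    · have h1 : AnalyticAt ℝ (fun x => (x - t₀)⁻¹ * (f x - f t₀)) t :=
        ((analyticAt_id.sub analyticAt_const).inv (sub_ne_zero.2 h)).mul
          ((hf t (mem_univ t)).sub analyticAt_const)
      refine h1.congr ?_
      filter_upwards [isOpen_ne.mem_nhds h] with x hx
      rw [dslope_of_ne _ hx, slope_def_field, div_eq_inv_mul]
  · have := sub_smul_dslope f t₀ t
    rw [h0, sub_zero, smul_eq_mul] at this
    exact this.symm

/-- Common zeros of an analytic kernel vector can be divided out if some entry divides a nonzero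
polynomial. -/
theorem exists_nonvanishing_kernel_vector {ι : Type*} [Fintype ι] {N : ℝ → Matrix ι ι ℝ}
    (hN : ∀ i j, Continuous fun t => N t i j) {v : ι → ℝ → ℝ}
    (hv : ∀ i, AnalyticOnNhd ℝ (v i) univ) (hNv : ∀ t, N t *ᵥ (fun i => v i t) = 0) {i : ι}
    {u : ℝ → ℝ} {q : ℝ[X]} (hq : q ≠ 0) (huc : Continuous u)
    (hu : ∀ t, v i t * u t = q.eval t) :
    ∃ w : ι → ℝ → ℝ, (∀ i, AnalyticOnNhd ℝ (w i) univ) ∧ ∀ t, N t *ᵥ (fun i => w i t) = 0 ∧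
      (fun i => w i t) ≠ 0 := by
  induction hd : q.natDegree using Nat.strong_induction_on generalizing q v u with
  | _ d ih =>
  -- A common zero of the entries is a root of `q`; dividing it out lowers the degree of `q`, so the
  -- process stops.
  by_cases hz : ∃ t₀, (fun i => v i t₀) = 0
  · obtain ⟨t₀, ht₀⟩ := hz
    choose w hw hvw using fun j => exists_eq_sub_mul_of_eq_zero (hv j) (congrFun ht₀ j)
    have hroot : q.IsRoot t₀ := by
      rw [IsRoot.def, ← hu, congrFun ht₀ i, Pi.zero_apply, zero_mul]
    obtain ⟨q', rfl⟩ := dvd_iff_isRoot.2 hroot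
    have hq' : q' ≠ 0 := right_ne_zero_of_mul hq
    have hcont : ∀ j, Continuous (w j) := fun j =>
      continuousOn_univ.1 (hw j).continuousOn
    have hdense : Dense ({t₀}ᶜ : Set ℝ) := dense_compl_singleton t₀
    have hmem : ∀ {t : ℝ}, t ∈ ({t₀}ᶜ : Set ℝ) → t - t₀ ≠ 0 := fun ht => sub_ne_zero.2 ht
    have hNw : ∀ t, N t *ᵥ (fun j => w j t) = 0 := by
      refine fun t => congrFun (Continuous.ext_on hdense (f := fun t => N t *ᵥ fun j => w j t)
        (g := fun _ => 0) ?_ continuous_const fun t ht => ?_) t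
      · refine continuous_pi fun k => ?_
        simp only [mulVec, dotProduct]
        fun_prop
      · have h1 := hNv t
        have h2 : (fun j => v j t) = (t - t₀) • fun j => w j t := funext fun j => hvw j t
        rw [h2, mulVec_smul] at h1
        exact (smul_eq_zero.1 h1).resolve_left (hmem ht)
    have huw : ∀ t, w i t * u t = q'.eval t := by
      refine fun t => congrFun (Continuous.ext_on hdense (f := fun t => w i t * u t)
        (g := fun t => q'.eval t) ((hcont i).mul huc) q'.continuous fun t ht => ?_) t
      have h1 := hu t
      rw [hvw, mul_assoc, eval_mul, eval_sub, eval_X, eval_C] at h1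
      exact mul_left_cancel₀ (hmem ht) h1
    refine ih _ ?_ hw hNw hq' huc huw rfl
    rw [← hd, natDegree_mul (X_sub_C_ne_zero t₀) hq', natDegree_X_sub_C]
    omega
  · exact ⟨v, hv, fun t => ⟨hNv t, fun h => hz ⟨t, h⟩⟩⟩

/-- An eigenvalue of a polynomial matrix in a domain of functions has an eigenvector in it. -/
theorem exists_eigenvector_of_charpoly_eval_eq_zero {ι D : Type*} [Fintype ι] [DecidableEq ι]
    [CommRing D] [IsDomain D] [Algebra ℝ[X] D] (e : ℝ → D →+* ℝ)
    (he : ∀ t q, e t (algebraMap ℝ[X] D q) = q.eval t) (hext : ∀ x, (∀ t, e t x = 0) → x = 0)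
    (M : Matrix ι ι ℝ[X]) (x : D) (h : ∀ t, (M.map (eval t)).charpoly.eval (e t x) = 0) :
    ∃ v : ι → D, v ≠ 0 ∧
      ∀ t, M.map (eval t) *ᵥ (fun j => e t (v j)) = e t x • fun j => e t (v j) := by
  let K : Matrix ι ι D := scalar ι x - M.map (algebraMap ℝ[X] D)
  have hK : ∀ t, K.map (e t) = scalar ι (e t x) - M.map (eval t) := fun t => by
    ext i j
    simp only [K, map_apply, Matrix.sub_apply, map_sub, he, scalar_apply, diagonal_apply]
    split_ifs
    · rfl
    · rw [map_zero]
  have hdet : K.det = 0 := hext _ fun t => by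
    rw [RingHom.map_det, RingHom.mapMatrix_apply, hK, ← eval_charpoly, h]
  obtain ⟨v, hv0, hKv⟩ := exists_mulVec_eq_zero_iff.2 hdet
  refine ⟨v, hv0, fun t => ?_⟩
  have h1 : K.map (e t) *ᵥ (fun j => e t (v j)) = 0 := by
    ext j
    have h2 := congrArg (e t) (congrFun hKv j)
    rwa [RingHom.map_mulVec, Pi.zero_apply, map_zero] at h2
  rw [hK, sub_mulVec, sub_eq_zero] at h1
  rw [← h1]
  ext j
  simp [scalar_apply, mulVec_diagonal]

/-- An analytic eigenvalue of a real pencil has an analytic nowhere vanishing eigenvector. -/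
theorem exists_analytic_eigenvector {ι : Type*} [Fintype ι] [DecidableEq ι] (A B : Matrix ι ι ℝ)
    {μ : ℝ → ℝ} (hμ : AnalyticOnNhd ℝ μ univ) (h : ∀ t, (A + t • B).charpoly.eval (μ t) = 0) :
    ∃ v : ι → ℝ → ℝ, (∀ i, AnalyticOnNhd ℝ (v i) univ) ∧
      ∀ t, (A + t • B) *ᵥ (fun i => v i t) = μ t • (fun i => v i t) ∧ (fun i => v i t) ≠ 0 := by
  let M : Matrix ι ι ℝ[X] := A.map C + (X : ℝ[X]) • B.map C
  let μ' : analyticSubalgebra := ⟨μ, hμ⟩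
  have hM : ∀ t, M.map (eval t) = A + t • B := fun t => by
    ext i j
    simp only [M, map_apply, Matrix.add_apply, Matrix.smul_apply, smul_eq_mul, eval_add, eval_mul,
      eval_C, eval_X]
  have hint : IsIntegral ℝ[X] μ' := by
    refine ⟨M.charpoly, M.charpoly_monic, ext_eval fun t => ?_⟩
    have h1 : (evalHom t).comp (algebraMap ℝ[X] analyticSubalgebra) = evalRingHom t :=
      RingHom.ext fun q => evalHom_algebraMap t q
    rw [hom_eval₂, h1, eval₂_eq_eval_map, ← charpoly_map, map_zero]
    exact (congrArg (fun K => (charpoly K).eval (μ t)) (hM t)).trans (h t)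
  -- The kernel vector is taken over the integral closure of `ℝ[X]`, not over all analytic
  -- functions, so that a nonzero entry is algebraic and divides a nonzero polynomial.
  obtain ⟨v, hv0, hMv⟩ := exists_eigenvector_of_charpoly_eval_eq_zero
    (D := integralClosure ℝ[X] analyticSubalgebra)
    (fun t => (evalHom t).comp (algebraMap _ analyticSubalgebra))
    (fun t q => evalHom_algebraMap t q)
    (fun x hx => Subtype.ext (ext_eval fun t => (hx t).trans (map_zero _).symm)) M ⟨μ', hint⟩
    (fun t => by rw [hM]; exact h t)
  obtain ⟨i, hi⟩ := Function.ne_iff.1 hv0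
  have hvi : (v i).1 ≠ 0 := fun h => hi (Subtype.ext h)
  obtain ⟨q, hq, u, hu⟩ := (IsIntegral.isAlgebraic (v i).2).exists_nonzero_dvd
    (mem_nonZeroDivisors_of_ne_zero hvi)
  have hμc : Continuous μ := continuousOn_univ.1 hμ.continuousOn
  have hN : ∀ t (y : ι → ℝ), (A + t • B) *ᵥ y = μ t • y ↔ (A + t • B - μ t • 1) *ᵥ y = 0 := by
    intro t y
    rw [sub_mulVec, sub_eq_zero, smul_mulVec, one_mulVec]
  have hNc : ∀ j k, Continuous fun t => (A + t • B - μ t • 1) j k := by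
    intro j k
    simp only [Matrix.sub_apply, Matrix.add_apply, Matrix.smul_apply, smul_eq_mul]
    fun_prop
  obtain ⟨w, hw, hNw⟩ := exists_nonvanishing_kernel_vector hNc (v := fun j => (v j).1.1)
    (fun j => (v j).1.2) (fun t => (hN t _).1 (by rw [← hM]; exact hMv t)) (i := i) hq
    (u := u.1) (continuousOn_univ.1 u.2.continuousOn)
    (fun t => by rw [← evalHom_algebraMap, hu, map_mul]; rfl)
  exact ⟨w, hw, fun t => ⟨(hN t _).2 (hNw t).1, (hNw t).2⟩⟩

/-- A pencil of real matrices with real spectrum has an analytic nowhere vanishing family of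
eigenvectors. -/
theorem exists_analytic_eigenvector_of_splits {ι : Type*} [Fintype ι] [DecidableEq ι] [Nonempty ι]
    (A B : Matrix ι ι ℝ) (h : ∀ t : ℝ, (A + t • B).charpoly.Splits) :
    ∃ (μ : ℝ → ℝ) (v : ι → ℝ → ℝ), (∀ i, AnalyticOnNhd ℝ (v i) univ) ∧
      ∀ t, (A + t • B) *ᵥ (fun i => v i t) = μ t • (fun i => v i t) ∧ (fun i => v i t) ≠ 0 := by
  have hcoeff : ∀ i, ∃ q : ℝ[X], ∀ t : ℝ, (A + t • B).charpoly.coeff i = q.eval t := fun i => by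
    refine ⟨(A.map C + (X : ℝ[X]) • B.map C).charpoly.coeff i, fun t => ?_⟩
    have hM : (A.map C + (X : ℝ[X]) • B.map C).map (evalRingHom t) = A + t • B := by
      ext i j
      simp only [map_apply, Matrix.add_apply, Matrix.smul_apply, smul_eq_mul, coe_evalRingHom,
        eval_add, eval_mul, eval_C, eval_X]
    rw [← hM, charpoly_map, coeff_map, coe_evalRingHom]
  have hana : ∀ i t₀, AnalyticAt ℝ (fun t : ℝ => (A + t • B).charpoly.coeff i) t₀ := fun i t₀ => by
    obtain ⟨q, hq⟩ := hcoeff i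
    simp only [hq]
    exact AnalyticOnNhd.eval_polynomial q t₀ (mem_univ t₀)
  obtain ⟨μ, hμ, hroot⟩ := exists_analytic_root (p := fun t => (A + t • B).charpoly)
    (fun t => charpoly_monic _) (fun t => charpoly_natDegree_eq_dim _) Fintype.card_ne_zero
    hana h
  exact ⟨μ, exists_analytic_eigenvector A B hμ hroot⟩

/-! ### Invariant subspaces and the two claims -/

/-- A symmetric pencil has an analytic nowhere vanishing family of eigenvectors in any nonzero
common invariant subspace. -/
theorem exists_analytic_eigenvector_mem {E : Type*} [NormedAddCommGroup E] [InnerProductSpace ℝ E]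
    [FiniteDimensional ℝ E] {S T : E →ₗ[ℝ] E} (hS : S.IsSymmetric) (hT : T.IsSymmetric)
    {W : Submodule ℝ E} (hW : W ≠ ⊥) (hSW : ∀ x ∈ W, S x ∈ W) (hTW : ∀ x ∈ W, T x ∈ W) :
    ∃ φ : ℝ → E, AnalyticOnNhd ℝ φ univ ∧
      ∀ t, φ t ∈ W ∧ φ t ≠ 0 ∧ ∃ μ : ℝ, (S + t • T) (φ t) = μ • φ t := by
  have : Nontrivial W := Submodule.nontrivial_iff_ne_bot.2 hW
  let b := Module.finBasis ℝ W
  have : Nonempty (Fin (Module.finrank ℝ W)) := ⟨⟨0, Module.finrank_pos⟩⟩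
  have hP : ∀ t : ℝ, ∀ x ∈ W, (S + t • T) x ∈ W := fun t x hx =>
    W.add_mem (hSW x hx) (W.smul_mem t (hTW x hx))
  have hPm : ∀ t : ℝ, LinearMap.toMatrix b b (S.restrict hSW) +
      t • LinearMap.toMatrix b b (T.restrict hTW) =
      LinearMap.toMatrix b b ((S + t • T).restrict (hP t)) := fun t => by
    rw [← map_smul, ← map_add]
    rfl
  -- The basis `b` need not be orthonormal, so these matrices need not be symmetric; only the
  -- splitting of the basis-independent characteristic polynomial matters.
  obtain ⟨μ, v, hv, hmv⟩ := exists_analytic_eigenvector_of_splits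
    (LinearMap.toMatrix b b (S.restrict hSW)) (LinearMap.toMatrix b b (T.restrict hTW))
    fun t => by
      rw [hPm, LinearMap.charpoly_toMatrix]
      have hsym : (S + t • T).IsSymmetric := hS.add (hT.smul (by simp))
      exact (hsym.restrict_invariant (hP t)).splits_charpoly
  refine ⟨fun t => ∑ i, v i t • (b i : E), fun t _ => ?_, fun t => ?_⟩
  · exact Finset.analyticAt_fun_sum _ fun i _ => (hv i t (mem_univ t)).smul analyticAt_const
  · obtain ⟨h1, h2⟩ := hmv t
    let x : W := b.equivFun.symm fun i => v i t
    have hx : (∑ i, v i t • (b i : E)) = x := by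
      simp [x, Module.Basis.equivFun_symm_apply]
    have hrepr : (b.repr x : _ → ℝ) = fun i => v i t := b.equivFun.apply_symm_apply _
    have hxx : (S + t • T).restrict (hP t) x = μ t • x := by
      apply b.repr.injective
      ext i
      rw [hPm, ← hrepr, LinearMap.toMatrix_mulVec_repr] at h1
      simpa using congrFun h1 i
    simp only [hx]
    refine ⟨x.2, fun h0 => h2 ?_, μ t, congrArg Subtype.val hxx⟩
    rw [← hrepr, show x = 0 from Subtype.ext h0]
    simp

theorem hasDegenerateSpectrum_of_commute {n : ℕ} {H O : Matrix (Fin n) (Fin n) ℝ} (hH : H.IsSymm)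
    (hO : O ∈ orthogonalGroup (Fin n) ℝ) (hOH : Commute O H) (hO2 : O ^ 2 ≠ 1) :
    HasDegenerateSpectrum H := by
  by_contra hdeg
  simp only [HasDegenerateSpectrum, not_exists, not_le] at hdeg
  have hHh : H.IsHermitian := by rw [IsHermitian, conjTranspose_eq_transpose_of_trivial, hH]
  let b := hHh.eigenvectorBasis
  have hST : Commute (O - Oᵀ) H := by
    have h2 : Commute Oᵀ H := by
      have h1 := congrArg transpose hOH.eq
      rw [transpose_mul, transpose_mul, hH] at h1
      exact h1.symm
    exact hOH.sub_left h2
  have hskew : ∀ x : Fin n → ℝ, x ⬝ᵥ ((O - Oᵀ) *ᵥ x) = 0 := fun x => by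
    rw [sub_mulVec, dotProduct_sub, mulVec_transpose, dotProduct_mulVec, dotProduct_comm x,
      sub_self]
  have hker : ∀ i, (O - Oᵀ) *ᵥ (b i).ofLp = 0 := fun i => by
    have hbi : H *ᵥ (b i).ofLp = hHh.eigenvalues i • (b i).ofLp := hHh.mulVec_eigenvectorBasis i
    have hne : (b i).ofLp ≠ 0 := fun h => b.toBasis.ne_zero i (by
      rw [OrthonormalBasis.coe_toBasis]; exact WithLp.ofLp_injective 2 h)
    -- The eigenspace is a line containing both `b i` and its image under `O - Oᵀ`; skewness makes
    -- them orthogonal, so the image vanishes.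
    obtain ⟨y, hy⟩ := finrank_le_one_iff.1 (Nat.le_of_lt_succ (hdeg (hHh.eigenvalues i)))
    obtain ⟨c, hc⟩ := hy ⟨(b i).ofLp, Module.End.mem_eigenspace_iff.2 hbi⟩
    obtain ⟨d, hd⟩ := hy ⟨(O - Oᵀ) *ᵥ (b i).ofLp, Module.End.mem_eigenspace_iff.2 (by
      rw [toLin'_apply, mulVec_mulVec, ← hST.eq, ← mulVec_mulVec, hbi, mulVec_smul])⟩
    have hc' : c • y.1 = (b i).ofLp := congrArg Subtype.val hc
    have hd' : d • y.1 = (O - Oᵀ) *ᵥ (b i).ofLp := congrArg Subtype.val hd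
    have hc0 : c ≠ 0 := fun h => hne (by rw [← hc', h, zero_smul])
    have hy' : y.1 = c⁻¹ • (b i).ofLp := by rw [← hc', smul_smul, inv_mul_cancel₀ hc0, one_smul]
    have h0 := hskew (b i).ofLp
    rw [← hd', hy', dotProduct_smul, dotProduct_smul, smul_eq_mul, smul_eq_mul, mul_eq_zero,
      mul_eq_zero, dotProduct_self_eq_zero] at h0
    have hd0 : d = 0 := h0.resolve_right fun h => h.elim (inv_ne_zero hc0) hne
    rw [← hd', hd0, zero_smul]
  have hS : toEuclideanLin (O - Oᵀ) = 0 := by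
    refine b.toBasis.ext fun i => WithLp.ofLp_injective 2 ?_
    rw [OrthonormalBasis.coe_toBasis, ofLp_toLpLin, toLin'_apply]
    exact hker i
  have hOO : O = Oᵀ := sub_eq_zero.1 ((LinearEquiv.map_eq_zero_iff _).1 hS)
  apply hO2
  have := (mem_orthogonalGroup_iff (Fin n) ℝ).1 hO
  rw [sq]
  nth_rw 2 [hOO]
  exact this

theorem exists_analytic_eigenvector_apply_eq_zero {n : ℕ} {A B O : Matrix (Fin n) (Fin n) ℝ}
    (hA : A.IsSymm) (hB : B.IsSymm) (hO : O ∈ orthogonalGroup (Fin n) ℝ) (hO1 : O ≠ 1)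
    (hOA : Commute O A) (hOB : Commute O B) {j : Fin n}
    (hj : O *ᵥ Pi.single j 1 = Pi.single j 1) :
    ∃ φ : ℝ → Fin n → ℝ, AnalyticOnNhd ℝ φ univ ∧ ∀ t : ℝ,
      (∃ μ : ℝ, Module.End.HasEigenvector (toLin' (pencil A B t)) μ (φ t)) ∧ φ t j = 0 := by
  have hsymm : ∀ {M : Matrix (Fin n) (Fin n) ℝ}, M.IsSymm → (toEuclideanLin M).IsSymmetric :=
    fun {M} hM => isSymmetric_toEuclideanLin_iff.2 (by
      rw [IsHermitian, conjTranspose_eq_transpose_of_trivial, hM])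
  let W := LinearMap.range (toEuclideanLin (O - 1))
  have hW : W ≠ ⊥ := by
    rw [Ne, LinearMap.range_eq_bot, LinearEquiv.map_eq_zero_iff, sub_eq_zero]
    exact hO1
  have hinv : ∀ {M : Matrix (Fin n) (Fin n) ℝ}, Commute O M →
      ∀ x ∈ W, toEuclideanLin M x ∈ W := by
    rintro M hM _ ⟨y, rfl⟩
    refine ⟨toEuclideanLin M y, WithLp.ofLp_injective 2 ?_⟩
    simp only [ofLp_toLpLin, toLin'_apply, mulVec_mulVec]
    rw [(hM.sub_left (Commute.one_left M)).eq]
  have hWj : ∀ x ∈ W, x j = 0 := by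
    rintro _ ⟨y, rfl⟩
    -- Orthogonality turns the fixed column vector into a fixed row vector, which annihilates the
    -- range of `O - 1`.
    have hrow : Pi.single j 1 ᵥ* O = Pi.single j 1 := by
      rw [← mulVec_transpose]
      nth_rw 1 [← hj]
      rw [mulVec_mulVec]
      have : Oᵀ * O = 1 := (mem_orthogonalGroup_iff' (Fin n) ℝ).1 hO
      rw [this, one_mulVec]
    have h1 : Pi.single j 1 ⬝ᵥ ((O - 1) *ᵥ y.ofLp) = 0 := by
      rw [dotProduct_mulVec, vecMul_sub, hrow, vecMul_one, sub_self, zero_dotProduct]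
    rwa [single_one_dotProduct] at h1
  obtain ⟨φ, hφ, hmem⟩ := exists_analytic_eigenvector_mem (hsymm hA) (hsymm hB) hW (hinv hOA)
    (hinv hOB)
  refine ⟨fun t => (φ t).ofLp, fun t ht => ?_, fun t => ?_⟩
  · exact ((EuclideanSpace.equiv (Fin n) ℝ).toContinuousLinearMap.analyticAt _).comp (hφ t ht)
  · obtain ⟨h1, h2, μ, h3⟩ := hmem t
    refine ⟨⟨μ, Module.End.mem_eigenspace_iff.2 ?_, fun h => h2 (WithLp.ofLp_injective 2 h)⟩,
      hWj _ h1⟩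
    rw [← map_smul, ← map_add] at h3
    exact congrArg WithLp.ofLp h3

theorem lemma3p2 (n : ℕ) (A B O : Matrix (Fin n) (Fin n) ℝ)
    (hA : A.IsSymm) (hB : B.IsSymm)
    (hO : O ∈ Matrix.orthogonalGroup (Fin n) ℝ) (hO1 : O ≠ 1)
    (hOA : Commute O A) (hOB : Commute O B) :
    (O ^ 2 ≠ 1 → ∀ t : ℝ, HasDegenerateSpectrum (pencil A B t)) ∧
    (∀ j : Fin n, Matrix.mulVec O (Pi.single j 1) = Pi.single j 1 →
      ∃ φ : ℝ → Fin n → ℝ, AnalyticOnNhd ℝ φ Set.univ ∧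
        ∀ t : ℝ,
          (∃ μ : ℝ, Module.End.HasEigenvector (Matrix.toLin' (pencil A B t)) μ (φ t)) ∧
          φ t j = 0) := by
  refine ⟨fun hO2 t => ?_, fun j hj => ?_⟩
  · exact hasDegenerateSpectrum_of_commute (hA.add (hB.smul t)) hO
      (hOA.add_right (hOB.smul_right t)) hO2
  · exact exists_analytic_eigenvector_apply_eq_zero hA hB hO hO1 hOA hOB hj
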